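/- All graphs are simple (no loops, no multiple edges), and $L^2$-spaces consist of real functions. Let $k \ge 1$ be an integer. For a connected $k$-regular graph $X=(V,E)$, finite or infinite, let $L^2(X)$ be the space of square-summable functions $V \to \mathbb{R}$ (counting measure), and let $M = M_X : L^2(X) \to L^2(X)$, $(Mf)(x) = \frac1k \sum_{y \sim x} f(y)$, be the Markov operator of the simple random walk on $X$. For a vertex $e$ let $\delta_e$ be its indicator function, and let $r_n = r_n(X,e)$ be the probability that the simple random walk started at $e$ is at $e$ at time $n$. If $X$ is bipartite, write $V = I \sqcup O$ for its bipartition; otherwise put $I = O = V$. Let $$L^2_0(X) = \Big\{ f \in L^2(X) : \sum_{x \in I} f(x) = \sum_{x \in O} f(x) = 0 \Big\}$$ (for infinite $X$ the sums are required to converge unconditionally), let $N = N_X$ be the restriction of $M$ to $L^2_0(X)$, and let $\|M\|$ and $\|N\|$ be the operator norms with respect to the $L^2$-norm. Then: 1. For every connected $k$-regular graph $X$ and every vertex $e$ of $X$, $$\|M\| = \limsup_{n \to \infty} r_n^{1/n} = \lim_{n \to \infty} r_{2n}^{1/(2n)} = \lim_{n\to\infty} \|M^n \delta_e\|^{1/n}.$$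 2. If $k \ge 2$ and $\tilde X$ is the $k$-regular tree, with Markov operator $\tilde M$, then $\|\tilde M\| = \dfrac{2\sqrt{k-1}}{k}$. 3. If $X$ is a connected $k$-regular graph, $r \ge 1$, and the diameter of $X$ is at least $2r+2$ (possibly infinite), then for the $k$-regular tree $\tilde X$ and any vertex $e$ of $\tilde X$ one has $\|N\| \ge \|\tilde M^r \delta_e\|^{1/r}$. 4. Let $(X_n)_{n \in \mathbb{N}}$ be an infinite family of connected $k$-regular graphs, in the sense that each $X_n$ is isomorphic to only finitely many of the graphs $X_m$ (for instance pairwise non-isomorphic graphs, or finite graphs with $|V(X_n)| \to \infty$), and let $N_n = N_{X_n}$. Then $$\liminf_{n \to \infty} \|N_n\| \ge \frac{2\sqrt{k-1}}{k}.$$ -/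

import Mathlib

open Filter Topology
open scoped ENNReal

noncomputable section

namespace RandomWalk

/-- The Hilbert space of square-summable real functions on `V` (counting measure). -/
abbrev L2 (V : Type*) : Type _ := lp (fun _ : V => ℝ) 2

variable {V : Type*}

open Classical in
/-- The indicator function of the vertex `e`, as an element of `L2 V`. -/
def delta (e : V) : L2 V := lp.single 2 e (1 : ℝ)

variable (G : SimpleGraph V) [G.LocallyFinite]

/-- `(1 / k) ∑_{y ∼ x} f y`. -/
def avg (k : ℕ) (f : V → ℝ) (x : V) : ℝ :=
  (k : ℝ)⁻¹ * ∑ y ∈ G.neighborFinset x, f y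

variable {G} {k : ℕ}

theorem avg_sq_le (hG : G.IsRegularOfDegree k) (f : V → ℝ) (x : V) :
    avg G k f x ^ 2 ≤ (k : ℝ)⁻¹ * ∑ y ∈ G.neighborFinset x, f y ^ 2 := by
  have h := sq_sum_le_card_mul_sum_sq (s := G.neighborFinset x) (f := f)
  rw [G.card_neighborFinset_eq_degree, hG x] at h
  rcases Nat.eq_zero_or_pos k with rfl | hk
  · simp [avg]
  · have hk' : (0 : ℝ) < k := by exact_mod_cast hk
    unfold avg
    rw [mul_pow]
    calc (k : ℝ)⁻¹ ^ 2 * (∑ y ∈ G.neighborFinset x, f y) ^ 2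
        ≤ (k : ℝ)⁻¹ ^ 2 * (k * ∑ y ∈ G.neighborFinset x, f y ^ 2) := by gcongr
      _ = (k : ℝ)⁻¹ * ∑ y ∈ G.neighborFinset x, f y ^ 2 := by field_simp

open Classical in
theorem sum_avg_sq_le (hG : G.IsRegularOfDegree k) (f : L2 V) (s : Finset V) :
    ∑ x ∈ s, avg G k f x ^ 2 ≤ ‖f‖ ^ 2 := by
  set t := s.biUnion fun x => G.neighborFinset x with ht
  have hf : ∑ y ∈ t, f y ^ 2 ≤ ‖f‖ ^ 2 := by
    have := lp.sum_rpow_le_norm_rpow (p := 2) (by norm_num) f t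
    simpa using this
  refine le_trans ?_ hf
  calc ∑ x ∈ s, avg G k f x ^ 2
      ≤ ∑ x ∈ s, (k : ℝ)⁻¹ * ∑ y ∈ G.neighborFinset x, f y ^ 2 :=
        Finset.sum_le_sum fun x _ => avg_sq_le hG f x
    _ = (k : ℝ)⁻¹ * ∑ x ∈ s, ∑ y ∈ t with G.Adj x y, f y ^ 2 := by
        rw [← Finset.mul_sum]
        congr 1
        refine Finset.sum_congr rfl fun x hx => Finset.sum_congr ?_ fun _ _ => rfl
        ext y
        simp only [SimpleGraph.mem_neighborFinset, Finset.mem_filter, ht, Finset.mem_biUnion]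
        exact ⟨fun h => ⟨⟨x, hx, h⟩, h⟩, fun h => h.2⟩
    _ = (k : ℝ)⁻¹ * ∑ y ∈ t, ∑ x ∈ s with G.Adj x y, f y ^ 2 := by
        congr 1
        simp only [Finset.sum_filter]
        exact Finset.sum_comm
    _ = ∑ y ∈ t, (k : ℝ)⁻¹ * ((s.filter fun x => G.Adj x y).card * f y ^ 2) := by
        rw [Finset.mul_sum]
        simp
    _ ≤ ∑ y ∈ t, f y ^ 2 := by
        refine Finset.sum_le_sum fun y _ => ?_
        have hc : (s.filter fun x => G.Adj x y).card ≤ k := by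
          rw [← hG y, ← G.card_neighborFinset_eq_degree]
          refine Finset.card_le_card fun x hx => ?_
          simpa using (Finset.mem_filter.1 hx).2.symm
        rw [← mul_assoc]
        refine mul_le_of_le_one_left (sq_nonneg _) ?_
        calc (k : ℝ)⁻¹ * ((s.filter fun x => G.Adj x y).card : ℝ)
            ≤ (k : ℝ)⁻¹ * k := by gcongr
          _ ≤ 1 := inv_mul_le_one

theorem memℓp_avg (hG : G.IsRegularOfDegree k) (f : L2 V) :
    Memℓp (fun x => avg G k f x) 2 := by
  refine memℓp_gen' (C := ‖f‖ ^ 2) fun s => ?_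
  simpa using sum_avg_sq_le hG f s

variable (G) in
/-- The Markov operator `M` of the simple random walk on a `k`-regular graph, as a bounded
operator on `L2 V`: `(M f) x = (1 / k) ∑_{y ∼ x} f y`. -/
def markov (hG : G.IsRegularOfDegree k) : L2 V →L[ℝ] L2 V :=
  LinearMap.mkContinuous
    { toFun := fun f => ⟨fun x => avg G k f x, memℓp_avg hG f⟩
      map_add' := fun f g => by
        ext x
        have h : avg G k (fun y => f y + g y) x = avg G k f x + avg G k g x := by
          simp only [avg, Finset.sum_add_distrib, mul_add]
        exact h
      map_smul' := fun c f => by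
        ext x
        simp only [avg, lp.coeFn_smul, Pi.smul_apply, smul_eq_mul, RingHom.id_apply,
          ← Finset.mul_sum]
        ring }
    1 (fun f => by
      refine lp.norm_le_of_forall_sum_le (p := 2) (by norm_num) (by positivity) fun s => ?_
      simpa using sum_avg_sq_le hG f s)

theorem markov_apply (hG : G.IsRegularOfDegree k) (f : L2 V) (x : V) :
    markov G hG f x = (k : ℝ)⁻¹ * ∑ y ∈ G.neighborFinset x, f y := rfl

/-- One step of the random walk from `v`: a uniformly chosen neighbour of `v`
(the walk stays put at an isolated vertex). -/
def stepLaw (G : SimpleGraph V) [G.LocallyFinite] (v : V) : PMF V :=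
  open Classical in
  if h : (G.neighborFinset v).Nonempty then PMF.uniformOfFinset (G.neighborFinset v) h
  else PMF.pure v

/-- The law at time `n` of the random walk started at `e`. -/
def walkLaw (G : SimpleGraph V) [G.LocallyFinite] (e : V) : ℕ → PMF V
  | 0 => PMF.pure e
  | n + 1 => (walkLaw G e n).bind (stepLaw G)

/-- The probability that the random walk started at `e` is at `e` at time `n`. -/
def returnProb (G : SimpleGraph V) [G.LocallyFinite] (e : V) (n : ℕ) : ℝ := (walkLaw G e n e).toReal

/-- The functions in `L2 V` whose sum over each part of the graph vanishes. The parts are the two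
sides of the bipartition if the graph is bipartite (for a connected graph the bipartition is
unique), and otherwise the only part is the whole vertex set. On an infinite vertex set,
"the sum vanishes" includes that the sum converges unconditionally. -/
def L20 (G : SimpleGraph V) : Submodule ℝ (L2 V) where
  carrier := {f |
    (¬ G.IsBipartite → HasSum (fun x : V => f x) 0) ∧
    ∀ I O : Set V, G.IsBipartiteWith I O → I ∪ O = Set.univ →
      HasSum (fun x : I => f x) 0 ∧ HasSum (fun x : O => f x) 0}
  zero_mem' := ⟨fun _ => by simp, fun I O _ _ =>
    ⟨by simp, by simp⟩⟩
  add_mem' := fun {f g} hf hg => ⟨fun h => by simpa using (hf.1 h).add (hg.1 h),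
    fun I O h h' => ⟨by simpa using (hf.2 I O h h').1.add (hg.2 I O h h').1,
      by simpa using (hf.2 I O h h').2.add (hg.2 I O h h').2⟩⟩
  smul_mem' := fun c f hf => ⟨fun h => by simpa using (hf.1 h).mul_left c,
    fun I O h h' => ⟨by simpa using (hf.2 I O h h').1.mul_left c,
      by simpa using (hf.2 I O h h').2.mul_left c⟩⟩

/-- The restriction `N` of the Markov operator to the subspace `L20`. -/
def markov0 (G : SimpleGraph V) [G.LocallyFinite] (hG : G.IsRegularOfDegree k) :
    L20 G →L[ℝ] L2 V :=
  (markov G hG).comp (L20 G).subtypeL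

end RandomWalk

end

/-! The operator `M` is symmetric, so Cauchy–Schwarz makes `n ↦ ‖M ^ n f‖` log-convex, and a bound
`C * ρ ^ n` on these norms forces `‖M f‖ ≤ ρ * ‖f‖`. By connectedness, growth `ρ ^ n` at one `delta
e` spreads to every finitely supported `f`, with constants that depend on `f` but drop out, and
density gives `‖M‖ ≤ ρ` (`norm_markov_le_of_growth`). This replaces the spectral theorem. Return
probabilities enter through `r_{2n} = ‖M ^ n δ_e‖ ^ 2`.

On the tree put `s = √(k - 1)`. The radial function `s ^ (-d)` satisfies `A φ ≤ 2 s φ` for the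
adjacency operator `A`, which bounds the norm above; truncations of `s ^ (-d) sin ((d + 1) θ)` bound
it below.

In any `k`-regular graph, the counts of non-backtracking walks obey the same recursion under `A` as
the sphere indicators of the tree, with nonnegative coefficients. Hence the tree minimises `‖M ^ r
δ‖` (`IsRadial.norm_markov_pow_delta_le_norm`). If `x` and `y` are at distance `2r + 2`, then `δ_x -
δ_y` lies in `L20` and its two halves stay orthogonal under `M ^ r`, so `‖N‖ ^ r` is at least the
tree value. In an infinite family only finitely many graphs have diameter below `2r + 2`; let `r →
∞`. -/

noncomputable section

namespace RandomWalk

/-! ### Log-convex sequences and their `n`-th roots. -/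

section LogConvex

variable {b : ℕ → ℝ}

theorem logConvex_pos (h0 : ∀ n, 0 ≤ b n) (h : ∀ n, b (n + 1) ^ 2 ≤ b n * b (n + 2))
    (h1 : 0 < b 1) (n : ℕ) : 0 < b n := by
  have key : ∀ m, 0 < b (m + 1) := by
    intro m
    induction m with
    | zero => exact h1
    | succ m ih =>
      refine (h0 _).lt_of_ne' fun hz => ?_
      have := h m
      rw [hz, mul_zero] at this
      nlinarith
  cases n with
  | zero =>
    refine (h0 _).lt_of_ne' fun hz => ?_
    have := h 0
    rw [hz, zero_mul] at this
    nlinarith [key 0]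
  | succ n => exact key n

theorem logConvex_mul_le (h0 : ∀ n, 0 ≤ b n) (h : ∀ n, b (n + 1) ^ 2 ≤ b n * b (n + 2))
    (h1 : 0 < b 1) (n : ℕ) : b 1 * b n ≤ b 0 * b (n + 1) := by
  have hp := logConvex_pos h0 h h1
  induction n with
  | zero => rw [mul_comm]
  | succ n ih =>
    refine le_of_mul_le_mul_right ?_ (hp n)
    calc b 1 * b (n + 1) * b n = (b 1 * b n) * b (n + 1) := by ring
      _ ≤ (b 0 * b (n + 1)) * b (n + 1) := by gcongr; exact h0 _
      _ = b 0 * b (n + 1) ^ 2 := by ring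
      _ ≤ b 0 * (b n * b (n + 2)) := by gcongr; exacts [h0 _, h n]
      _ = b 0 * b (n + 1 + 1) * b n := by ring

theorem logConvex_pow_mul_le (h0 : ∀ n, 0 ≤ b n) (h : ∀ n, b (n + 1) ^ 2 ≤ b n * b (n + 2))
    (h1 : 0 < b 1) (n : ℕ) : b 1 ^ n * b 0 ≤ b 0 ^ n * b n := by
  induction n with
  | zero => simp
  | succ n ih =>
    calc b 1 ^ (n + 1) * b 0 = b 1 * (b 1 ^ n * b 0) := by ring
      _ ≤ b 1 * (b 0 ^ n * b n) := by gcongr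
      _ = b 0 ^ n * (b 1 * b n) := by ring
      _ ≤ b 0 ^ n * (b 0 * b (n + 1)) := by
        gcongr ?_ * ?_
        · exact pow_nonneg (h0 _) _
        · exact logConvex_mul_le h0 h h1 n
      _ = b 0 ^ (n + 1) * b (n + 1) := by ring

/-- Successive ratios increase, so an initial ratio above `ρ` would make `b` outgrow `C * ρ ^ n`
whatever `C` is. -/
theorem logConvex_le_of_growth (h0 : ∀ n, 0 ≤ b n) (h : ∀ n, b (n + 1) ^ 2 ≤ b n * b (n + 2))
    {C ρ : ℝ} (hρ : 0 < ρ) (hC : ∀ n, b n ≤ C * ρ ^ n) : b 1 ≤ ρ * b 0 := by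
  by_contra! hlt
  have h1 : 0 < b 1 := lt_of_le_of_lt (mul_nonneg hρ.le (h0 0)) hlt
  have hb0 : 0 < b 0 := logConvex_pos h0 h h1 0
  have hq : 1 < b 1 / (ρ * b 0) := (one_lt_div (by positivity)).2 hlt
  obtain ⟨n, hn⟩ := pow_unbounded_of_one_lt (C / b 0) hq
  have key := logConvex_pow_mul_le h0 h h1 n
  rw [div_pow, mul_pow, div_lt_div_iff₀ hb0 (by positivity)] at hn
  have : b 0 ^ n * b n ≤ b 0 ^ n * (C * ρ ^ n) := by gcongr; exact hC n
  nlinarith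

/-- The function `log b` is convex and vanishes at `0`, so its slopes `log (b n) / n` from the
origin increase; this is that fact without roots. -/
theorem logConvex_pow_succ_le (h0 : ∀ n, 0 ≤ b n) (h : ∀ n, b (n + 1) ^ 2 ≤ b n * b (n + 2))
    (h1 : 0 < b 1) (hb : b 0 = 1) (n : ℕ) : b n ^ (n + 1) ≤ b (n + 1) ^ n := by
  have hp := logConvex_pos h0 h h1
  induction n with
  | zero => simp [hb]
  | succ n ih =>
    refine le_of_mul_le_mul_right ?_ (pow_pos (hp (n + 1)) n)
    calc b (n + 1) ^ (n + 1 + 1) * b (n + 1) ^ n = (b (n + 1) ^ 2) ^ (n + 1) := by ring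
      _ ≤ (b n * b (n + 2)) ^ (n + 1) := by gcongr; exact h n
      _ = b n ^ (n + 1) * b (n + 2) ^ (n + 1) := by ring
      _ ≤ b (n + 1) ^ n * b (n + 2) ^ (n + 1) := by
        gcongr; exact pow_nonneg (h0 _) _
      _ = b (n + 1 + 1) ^ (n + 1) * b (n + 1) ^ n := by ring

theorem logConvex_rpow_mono (h0 : ∀ n, 0 ≤ b n) (h : ∀ n, b (n + 1) ^ 2 ≤ b n * b (n + 2))
    (h1 : 0 < b 1) (hb : b 0 = 1) :
    Monotone fun n : ℕ => b (n + 1) ^ (1 / ((n + 1 : ℕ) : ℝ)) := by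
  refine monotone_nat_of_le_succ fun n => ?_
  have key := logConvex_pow_succ_le h0 h h1 hb (n + 1)
  have e1 : (((n + 1 : ℕ) : ℝ)) ≠ 0 := by positivity
  have e2 : (((n + 1 + 1 : ℕ) : ℝ)) ≠ 0 := by positivity
  have := Real.rpow_le_rpow (pow_nonneg (h0 _) _) key
    (z := 1 / (((n + 1 : ℕ) : ℝ) * ((n + 1 + 1 : ℕ) : ℝ))) (by positivity)
  rwa [← Real.rpow_natCast, ← Real.rpow_natCast, ← Real.rpow_mul (h0 _),
    ← Real.rpow_mul (h0 _), mul_one_div, mul_one_div, div_mul_cancel_left₀ e1,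
    div_mul_cancel_right₀ e2, ← one_div, ← one_div] at this

/-- For a log-convex sequence dominated by `ρ ^ n`, the `n`-th roots converge to the least
such `ρ`. -/
theorem logConvex_tendsto (h0 : ∀ n, 0 ≤ b n) (h : ∀ n, b (n + 1) ^ 2 ≤ b n * b (n + 2))
    (h1 : 0 < b 1) (hb : b 0 = 1) {R : ℝ} (hR : 0 ≤ R) (hle : ∀ n, b n ≤ R ^ n)
    (hleast : ∀ ρ, 0 < ρ → (∀ n, b n ≤ ρ ^ n) → R ≤ ρ) :
    Tendsto (fun n : ℕ => b n ^ (1 / (n : ℝ))) atTop (𝓝 R) := by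
  -- At `n = 0` the exponent `1 / 0` is `0` and the term is `1`, which can break monotonicity; the
  -- shift discards it.
  refine (tendsto_add_atTop_iff_nat 1).1 ?_
  have hmono := logConvex_rpow_mono h0 h h1 hb
  have hbd : ∀ n : ℕ, b (n + 1) ^ (1 / ((n + 1 : ℕ) : ℝ)) ≤ R := fun n => by
    rw [one_div, Real.rpow_inv_le_iff_of_pos (h0 _) hR (by positivity), Real.rpow_natCast]
    exact hle _
  have hB : BddAbove (Set.range fun n : ℕ => b (n + 1) ^ (1 / ((n + 1 : ℕ) : ℝ))) :=
    ⟨R, by rintro _ ⟨n, rfl⟩; exact hbd n⟩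
  have ht := tendsto_atTop_ciSup hmono hB
  set ρ := ⨆ n : ℕ, b (n + 1) ^ (1 / ((n + 1 : ℕ) : ℝ)) with hρ
  have hρ0 : 0 < ρ := lt_of_lt_of_le (Real.rpow_pos_of_pos h1 _) (le_ciSup hB 0)
  have hle' : ρ ≤ R := ciSup_le hbd
  have hge : R ≤ ρ := hleast ρ hρ0 fun n => by
    cases n with
    | zero => simp [hb]
    | succ n =>
      rw [← Real.rpow_natCast, ← Real.rpow_inv_le_iff_of_pos (h0 _) hρ0.le (by positivity),
        ← one_div]
      exact le_ciSup hB n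
  rwa [le_antisymm hge hle']

end LogConvex

/-! ### Iterates of a symmetric operator. -/

section Symmetric

open scoped InnerProductSpace

variable {E : Type*} [NormedAddCommGroup E] [InnerProductSpace ℝ E] {T : E →L[ℝ] E}

theorem inner_pow_left (hT : ∀ f g : E, ⟪T f, g⟫_ℝ = ⟪f, T g⟫_ℝ) (n : ℕ) (f g : E) :
    ⟪(T ^ n) f, g⟫_ℝ = ⟪f, (T ^ n) g⟫_ℝ := by
  induction n generalizing f with
  | zero => rfl
  | succ n ih => rw [pow_succ, mul_apply_eq_comp, ih, hT, ← mul_apply_eq_comp, ← pow_succ', pow_succ]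

theorem inner_pow_pow (hT : ∀ f g : E, ⟪T f, g⟫_ℝ = ⟪f, T g⟫_ℝ) (m n : ℕ) (f g : E) :
    ⟪(T ^ m) f, (T ^ n) g⟫_ℝ = ⟪(T ^ (m + n)) f, g⟫_ℝ := by
  rw [← inner_pow_left hT n, add_comm, pow_add]; rfl

/-- Symmetry moves one factor `T` across the inner product; then Cauchy–Schwarz applies. -/
theorem norm_pow_succ_sq_le (hT : ∀ f g : E, ⟪T f, g⟫_ℝ = ⟪f, T g⟫_ℝ) (f : E) (n : ℕ) :
    ‖(T ^ (n + 1)) f‖ ^ 2 ≤ ‖(T ^ n) f‖ * ‖(T ^ (n + 2)) f‖ := by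
  rw [← real_inner_self_eq_norm_sq, inner_pow_pow hT,
    show n + 1 + (n + 1) = n + 2 + n by ring, ← inner_pow_pow hT, mul_comm]
  exact real_inner_le_norm _ _

/-- A symmetric operator whose iterates at `f` grow at most like `ρ ^ n` expands `f` at most by
the factor `ρ`. -/
theorem norm_apply_le_of_growth (hT : ∀ f g : E, ⟪T f, g⟫_ℝ = ⟪f, T g⟫_ℝ) (f : E) {C ρ : ℝ}
    (hρ : 0 < ρ) (hC : ∀ n, ‖(T ^ n) f‖ ≤ C * ρ ^ n) : ‖T f‖ ≤ ρ * ‖f‖ := by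
  simpa using logConvex_le_of_growth (b := fun n => ‖(T ^ n) f‖) (fun n => norm_nonneg _)
    (norm_pow_succ_sq_le hT f) hρ hC

end Symmetric

/-! ### The Markov operator, its norm and return probabilities. -/

section Markov

open scoped InnerProductSpace

variable {V : Type*}

theorem delta_apply [DecidableEq V] (e x : V) : delta e x = if x = e then 1 else 0 := by
  simp only [delta, lp.single_apply, Pi.single_apply]
  split_ifs <;> simp_all

theorem inner_delta_right (f : L2 V) (e : V) : ⟪f, delta e⟫_ℝ = f e := by
  classical
  rw [show delta e = lp.single 2 e (1 : ℝ) by unfold delta; congr!, lp.inner_single_right]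
  simp

theorem norm_delta (e : V) : ‖delta e‖ = 1 := by
  classical
  rw [delta, lp.norm_single (by norm_num)]
  simp

theorem hasSum_smul_delta (f : L2 V) : HasSum (fun x => f x • delta x) f := by
  classical
  convert! lp.hasSum_single (p := 2) (by norm_num) f using 2 with x
  rw [delta, ← lp.single_smul]
  simp

variable (G : SimpleGraph V) [G.LocallyFinite]

/-- The sum of `f` over the neighbours of `x`. -/
def nbrSum (f : V → ℝ) (x : V) : ℝ := ∑ y ∈ G.neighborFinset x, f y

theorem nbrSum_nonneg {f : V → ℝ} (hf : 0 ≤ f) : 0 ≤ nbrSum G f :=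
  fun _ => Finset.sum_nonneg fun y _ => hf y

theorem nbrSum_mono : Monotone (nbrSum G) :=
  fun _ _ hfg _ => Finset.sum_le_sum fun y _ => hfg y

theorem nbrSum_add (f g : V → ℝ) : nbrSum G (f + g) = nbrSum G f + nbrSum G g := by
  ext x; simp [nbrSum, Finset.sum_add_distrib]

theorem nbrSum_smul (c : ℝ) (f : V → ℝ) : nbrSum G (c • f) = c • nbrSum G f := by
  ext x; simp [nbrSum, Finset.mul_sum]

theorem nbrSum_iterate_smul (c : ℝ) (f : V → ℝ) (n : ℕ) :
    (nbrSum G)^[n] (c • f) = c • (nbrSum G)^[n] f := by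
  induction n generalizing f with
  | zero => rfl
  | succ n ih => rw [Function.iterate_succ_apply, nbrSum_smul, ih, Function.iterate_succ_apply]

theorem nbrSum_iterate_nonneg {f : V → ℝ} (hf : 0 ≤ f) (n : ℕ) : 0 ≤ (nbrSum G)^[n] f := by
  induction n generalizing f with
  | zero => exact hf
  | succ n ih => exact ih (nbrSum_nonneg G hf)

variable {G} {k : ℕ}

theorem coe_markov (hG : G.IsRegularOfDegree k) (f : L2 V) :
    ⇑(markov G hG f) = (k : ℝ)⁻¹ • nbrSum G f := rfl

theorem coe_markov_pow (hG : G.IsRegularOfDegree k) (n : ℕ) (f : L2 V) :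
    ⇑((markov G hG ^ n) f) = ((k : ℝ)⁻¹) ^ n • (nbrSum G)^[n] f := by
  induction n generalizing f with
  | zero => simp
  | succ n ih =>
    rw [pow_succ, mul_apply_eq_comp, ih, coe_markov, nbrSum_iterate_smul, smul_smul,
      Function.iterate_succ_apply, pow_succ]

theorem norm_markov_le_one (hG : G.IsRegularOfDegree k) : ‖markov G hG‖ ≤ 1 :=
  LinearMap.mkContinuous_norm_le _ zero_le_one _

/-- Both sides are continuous and linear in `g`, so `g = delta b` suffices; there it is the symmetry
of adjacency. -/
theorem markov_symmetric (hG : G.IsRegularOfDegree k) (f g : L2 V) :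
    ⟪markov G hG f, g⟫_ℝ = ⟪f, markov G hG g⟫_ℝ := by
  classical
  have key : ∀ b, ⟪markov G hG f, delta b⟫_ℝ = ⟪f, markov G hG (delta b)⟫_ℝ := fun b => by
    have : markov G hG (delta b) = (k : ℝ)⁻¹ • ∑ y ∈ G.neighborFinset b, delta y := by
      ext x
      rw [coe_markov]
      simp only [nbrSum, Pi.smul_apply, lp.coeFn_smul, lp.coeFn_sum, Finset.sum_apply,
        delta_apply, Finset.sum_ite_eq', Finset.sum_ite_eq, SimpleGraph.mem_neighborFinset,
        G.adj_comm]
    rw [this, inner_delta_right, inner_smul_right, inner_sum]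
    simp only [inner_delta_right]
    rfl
  have h1 := (hasSum_smul_delta g).mapL (innerSL ℝ (markov G hG f))
  have h2 := ((hasSum_smul_delta g).mapL (markov G hG)).mapL (innerSL ℝ f)
  simp only [map_smul, innerSL_apply_apply, key] at h1 h2
  exact h1.unique h2

theorem norm_le_norm_of_le {f g : L2 V} (hf : 0 ≤ ⇑f) (hfg : ⇑f ≤ ⇑g) : ‖f‖ ≤ ‖g‖ :=
  lp.norm_mono (by norm_num) fun i => by
    rw [Real.norm_of_nonneg (hf i), Real.norm_of_nonneg ((hf i).trans (hfg i))]
    exact hfg i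

theorem delta_nonneg (e : V) : 0 ≤ ⇑(delta e) := fun x => by
  classical
  rw [delta_apply]
  positivity

theorem nbrSum_iterate_mono (n : ℕ) : Monotone (nbrSum G)^[n] := (nbrSum_mono G).iterate n

/-- Pointwise `delta w ≤ nbrSum G (delta v)`, and `nbrSum` preserves order. -/
theorem norm_markov_pow_delta_le_of_adj (hG : G.IsRegularOfDegree k) (hk : 1 ≤ k) {v w : V}
    (h : G.Adj v w) (n : ℕ) :
    ‖(markov G hG ^ n) (delta w)‖ ≤ k * ‖(markov G hG ^ (n + 1)) (delta v)‖ := by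
  classical
  have hk' : (0 : ℝ) < k := by exact_mod_cast hk
  have hle : ⇑(delta w) ≤ nbrSum G (delta v) := fun x => by
    by_cases hx : x = w
    · subst hx
      calc delta x x = delta v v := by simp [delta_apply]
        _ ≤ _ := Finset.single_le_sum (f := fun y => delta v y) (fun y _ => delta_nonneg v y)
            (by simpa using h.symm)
    · rw [delta_apply, if_neg hx]
      exact nbrSum_nonneg G (delta_nonneg v) x
  rw [← Real.norm_of_nonneg hk'.le, ← norm_smul]
  refine norm_le_norm_of_le ?_ ?_
  · rw [coe_markov_pow]
    exact smul_nonneg (by positivity) (nbrSum_iterate_nonneg G (delta_nonneg w) n)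
  · rw [lp.coeFn_smul, coe_markov_pow, coe_markov_pow, smul_smul, pow_succ',
      mul_inv_cancel_left₀ hk'.ne']
    exact smul_le_smul_of_nonneg_left (nbrSum_iterate_mono n hle) (by positivity)

theorem norm_markov_le_of_growth (hG : G.IsRegularOfDegree k) (hk : 1 ≤ k) (hc : G.Connected)
    (e : V) {ρ : ℝ} (hρ : 0 < ρ) (h : ∀ n, ‖(markov G hG ^ n) (delta e)‖ ≤ ρ ^ n) :
    ‖markov G hG‖ ≤ ρ := by
  have h1 : ∀ v, ∃ C, 0 ≤ C ∧ ∀ n, ‖(markov G hG ^ n) (delta v)‖ ≤ C * ρ ^ n := by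
    intro v
    obtain ⟨p⟩ := hc v e
    induction p with
    | nil => exact ⟨1, zero_le_one, by simpa using h⟩
    | @cons a b _ hab q ih =>
      obtain ⟨C, hC, hn⟩ := ih h
      refine ⟨k * C * ρ, by positivity, fun n => ?_⟩
      refine (norm_markov_pow_delta_le_of_adj hG hk hab.symm n).trans ?_
      calc (k : ℝ) * ‖(markov G hG ^ (n + 1)) (delta b)‖ ≤ k * (C * ρ ^ (n + 1)) := by
            gcongr; exact hn _
        _ = _ := by ring
  have h2 : ∀ (f : V → ℝ) (s : Finset V), ∃ C, 0 ≤ C ∧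
      ∀ n, ‖(markov G hG ^ n) (∑ x ∈ s, f x • delta x)‖ ≤ C * ρ ^ n := by
    intro f s
    choose C hC hn using h1
    refine ⟨∑ x ∈ s, |f x| * C x, Finset.sum_nonneg fun x _ =>
      mul_nonneg (abs_nonneg _) (hC x), fun n => ?_⟩
    rw [map_sum, Finset.sum_mul]
    refine norm_sum_le_of_le s fun x _ => ?_
    rw [map_smul, norm_smul, mul_assoc, Real.norm_eq_abs]
    gcongr
    exact hn x n
  refine ContinuousLinearMap.opNorm_le_bound _ hρ.le fun f => ?_
  have ht : Tendsto (fun s : Finset V => ∑ x ∈ s, f x • delta x) atTop (𝓝 f) :=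
    hasSum_smul_delta f
  refine le_of_tendsto_of_tendsto' (((markov G hG).continuous.norm.tendsto _).comp ht)
    ((ht.norm).const_mul ρ) fun s => ?_
  obtain ⟨C, -, hC⟩ := h2 f s
  -- The constant `C` depends on `f` and `s`, but the resulting bound does not, so it survives the
  -- limit over `s`.
  exact norm_apply_le_of_growth (markov_symmetric hG) _ hρ hC

theorem markov_delta_pos (hG : G.IsRegularOfDegree k) (hk : 1 ≤ k) (e : V) :
    0 < ‖(markov G hG ^ 1) (delta e)‖ := by
  classical
  have hne : (G.neighborFinset e).Nonempty := by
    rw [← Finset.card_pos, G.card_neighborFinset_eq_degree, hG e]; exact hk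
  obtain ⟨w, hw⟩ := hne
  have := norm_markov_pow_delta_le_of_adj hG hk (by simpa using hw : G.Adj e w) 0
  rw [pow_zero, one_apply_eq_self, norm_delta] at this
  refine (norm_nonneg _).lt_of_ne fun hz => ?_
  rw [zero_add, ← hz] at this
  norm_num at this

theorem norm_pow_apply_le_pow {E : Type*} [NormedAddCommGroup E] [NormedSpace ℝ E]
    (T : E →L[ℝ] E) (f : E) (n : ℕ) : ‖(T ^ n) f‖ ≤ ‖T‖ ^ n * ‖f‖ := by
  induction n with
  | zero => simp
  | succ n ih =>
    rw [pow_succ', mul_apply_eq_comp, pow_succ', mul_assoc]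
    exact (T.le_opNorm _).trans (by gcongr)

theorem tendsto_norm_markov_pow_delta (hG : G.IsRegularOfDegree k) (hk : 1 ≤ k)
    (hc : G.Connected) (e : V) :
    Tendsto (fun n : ℕ => ‖(markov G hG ^ n) (delta e)‖ ^ (1 / (n : ℝ))) atTop
      (𝓝 ‖markov G hG‖) :=
  logConvex_tendsto (b := fun n => ‖(markov G hG ^ n) (delta e)‖) (fun _ => norm_nonneg _) (norm_pow_succ_sq_le (markov_symmetric hG) _)
    (markov_delta_pos hG hk e) (by simp [norm_delta]) (norm_nonneg _)
    (fun n => by simpa [norm_delta] using norm_pow_apply_le_pow (markov G hG) (delta e) n)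
    (fun _ hρ h => norm_markov_le_of_growth hG hk hc e hρ h)

theorem norm_markov_pow_delta_sq (hG : G.IsRegularOfDegree k) (e : V) (n : ℕ) :
    ‖(markov G hG ^ n) (delta e)‖ ^ 2 = (markov G hG ^ (2 * n)) (delta e) e := by
  rw [← real_inner_self_eq_norm_sq, inner_pow_pow (markov_symmetric hG), inner_delta_right,
    two_mul]

open Classical in
theorem stepLaw_toReal (hG : G.IsRegularOfDegree k) (hk : 1 ≤ k) (v x : V) :
    (stepLaw G v x).toReal = (k : ℝ)⁻¹ * if G.Adj x v then 1 else 0 := by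
  have hne : (G.neighborFinset v).Nonempty := by
    rw [← Finset.card_pos, G.card_neighborFinset_eq_degree, hG v]; exact hk
  rw [stepLaw, dif_pos hne, PMF.uniformOfFinset_apply, G.card_neighborFinset_eq_degree, hG v]
  simp only [SimpleGraph.mem_neighborFinset, G.adj_comm]
  split_ifs <;> simp

/-- On a regular graph the transition matrix is symmetric, so laws evolve by the same operator as
functions. -/
theorem walkLaw_toReal (hG : G.IsRegularOfDegree k) (hk : 1 ≤ k) (e : V) (n : ℕ) (x : V) :
    (walkLaw G e n x).toReal = (markov G hG ^ n) (delta e) x := by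
  classical
  induction n generalizing x with
  | zero =>
    simp only [walkLaw, PMF.pure_apply, pow_zero, one_apply_eq_self, delta_apply]
    split_ifs <;> simp
  | succ n ih =>
    rw [walkLaw, PMF.bind_apply, ENNReal.tsum_toReal_eq
      (fun v => ENNReal.mul_ne_top (PMF.apply_ne_top _ _) (PMF.apply_ne_top _ _)), pow_succ',
      mul_apply_eq_comp, markov_apply, tsum_eq_sum (s := G.neighborFinset x),
      Finset.mul_sum]
    · refine Finset.sum_congr rfl fun v hv => ?_
      rw [ENNReal.toReal_mul, stepLaw_toReal hG hk, ih,
        if_pos ((G.mem_neighborFinset x v).1 hv)]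
      ring
    · intro v hv
      rw [ENNReal.toReal_mul, stepLaw_toReal hG hk,
        if_neg fun h => hv ((G.mem_neighborFinset x v).2 h)]
      ring

theorem returnProb_eq (hG : G.IsRegularOfDegree k) (hk : 1 ≤ k) (e : V) (n : ℕ) :
    returnProb G e n = (markov G hG ^ n) (delta e) e := walkLaw_toReal hG hk e n e

theorem tendsto_returnProb_even (hG : G.IsRegularOfDegree k) (hk : 1 ≤ k)
    (hc : G.Connected) (e : V) :
    Tendsto (fun n : ℕ => returnProb G e (2 * n) ^ (1 / (2 * (n : ℝ)))) atTop
      (𝓝 ‖markov G hG‖) := by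
  refine (tendsto_norm_markov_pow_delta hG hk hc e).congr fun n => ?_
  rw [returnProb_eq hG hk, ← norm_markov_pow_delta_sq, ← Real.rpow_natCast,
    ← Real.rpow_mul (norm_nonneg _)]
  congr 1
  push_cast
  rw [mul_one_div, ← mul_div_mul_left 1 (n : ℝ) two_ne_zero, mul_one]

theorem returnProb_le (hG : G.IsRegularOfDegree k) (hk : 1 ≤ k) (e : V) (n : ℕ) :
    returnProb G e n ≤ ‖markov G hG‖ ^ n := by
  rw [returnProb_eq hG hk, ← inner_delta_right]
  refine (real_inner_le_norm _ _).trans ?_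
  rw [norm_delta, mul_one]
  simpa [norm_delta] using norm_pow_apply_le_pow (markov G hG) (delta e) n

theorem limsup_returnProb (hG : G.IsRegularOfDegree k) (hk : 1 ≤ k)
    (hc : G.Connected) (e : V) :
    limsup (fun n : ℕ => returnProb G e n ^ (1 / (n : ℝ))) atTop = ‖markov G hG‖ := by
  have hle : ∀ᶠ n : ℕ in atTop, returnProb G e n ^ (1 / (n : ℝ)) ≤ ‖markov G hG‖ := by
    filter_upwards [eventually_gt_atTop 0] with n hn
    rw [one_div, Real.rpow_inv_le_iff_of_pos (x := returnProb G e n) ENNReal.toReal_nonneg (norm_nonneg _)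
      (by exact_mod_cast hn), Real.rpow_natCast]
    exact returnProb_le hG hk e n
  have h0 : ∀ n : ℕ, 0 ≤ returnProb G e n ^ (1 / (n : ℝ)) :=
    fun n => Real.rpow_nonneg ENNReal.toReal_nonneg _
  refine le_antisymm (limsup_le_of_le (isCoboundedUnder_le_of_le atTop h0) hle) ?_
  refine le_of_forall_lt fun a ha => ?_
  obtain ⟨c, hac, hc'⟩ := exists_between ha
  refine hac.trans_le (le_limsup_of_frequently_le ?_ ⟨_, eventually_map.2 hle⟩)
  have hev := (tendsto_returnProb_even hG hk hc e).eventually_const_lt hc'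
  have h2 : Tendsto (fun n : ℕ => 2 * n) atTop atTop :=
    tendsto_id.const_mul_atTop' two_pos
  -- Even times suffice for the lower bound; at odd times the return probability may vanish.
  refine h2.frequently (Eventually.frequently ?_)
  filter_upwards [hev] with n hn
  push_cast
  exact hn.le

end Markov

/-! ### Radial functions on a regular tree and the norm of its Markov operator. -/

section Radial

variable {V W : Type*}

/-- `d` looks like the distance to the root `e` of a tree: it changes by one along each edge, it
vanishes only at `e`, and every other vertex has exactly one neighbour closer to the root. -/
structure IsRadial (G : SimpleGraph V) (e : V) (d : V → ℕ) : Prop where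
  eq_zero_iff : ∀ v, d v = 0 ↔ v = e
  adj : ∀ {v w}, G.Adj v w → d w = d v + 1 ∨ d v = d w + 1
  existsUnique_parent : ∀ v, d v ≠ 0 → ∃! w, G.Adj v w ∧ d v = d w + 1

theorem isRadial_dist {G : SimpleGraph V} (hG : G.IsTree) (e : V) : IsRadial G e (G.dist e) where
  eq_zero_iff v := by rw [hG.connected.dist_eq_zero_iff, eq_comm]
  adj h := (hG.dist_eq_dist_add_one_of_adj e h).symm
  existsUnique_parent v hv := by
    obtain ⟨p, hp⟩ := hG.connected.exists_walk_length_eq_dist e v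
    have hnil : ¬ p.Nil := fun h => hv (by rw [← hp]; exact SimpleGraph.Walk.length_eq_zero_iff.2 h)
    have hadj : G.Adj v p.penultimate := (p.adj_penultimate hnil).symm
    refine ⟨p.penultimate, ⟨hadj, ?_⟩, ?_⟩
    · have h1 := G.dist_le p.dropLast
      rw [SimpleGraph.Walk.length_dropLast] at h1
      rcases hG.dist_eq_dist_add_one_of_adj e hadj with h | h <;> lia
    · rintro w ⟨hw, hd⟩
      obtain ⟨q, hq⟩ := hG.connected.exists_walk_length_eq_dist e w
      have h1 : (q.concat hw.symm).IsPath :=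
        SimpleGraph.Walk.isPath_of_length_eq_dist _ (by simp [hq, hd])
      have h2 : p.IsPath := SimpleGraph.Walk.isPath_of_length_eq_dist _ hp
      -- Any neighbour closer to `e` extends to a geodesic ending at `v`; paths in a tree are
      -- unique, so it is the penultimate vertex of `p`.
      rw [← (hG.existsUnique_path e v).unique h1 h2]
      simp

namespace IsRadial

variable {G : SimpleGraph V} {e : V} {d : V → ℕ}

theorem connected (h : IsRadial G e d) : G.Connected := by
  have key : ∀ n v, d v = n → G.Reachable e v := by
    intro n
    induction n with
    | zero => intro v hv; rw [(h.eq_zero_iff v).1 hv]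
    | succ n ih =>
      intro v hv
      obtain ⟨w, ⟨hw, hd⟩, -⟩ := h.existsUnique_parent v (by lia)
      exact (ih w (by lia)).trans hw.symm.reachable
  have : Nonempty V := ⟨e⟩
  exact ⟨fun v w => (key _ v rfl).symm.trans (key _ w rfl)⟩

variable [G.LocallyFinite] {k : ℕ}

theorem finite_le (h : IsRadial G e d) (n : ℕ) : {v | d v ≤ n}.Finite := by
  induction n with
  | zero =>
    refine (Set.finite_singleton e).subset fun v hv => ?_
    exact (h.eq_zero_iff v).1 (Nat.le_zero.1 hv)
  | succ n ih =>
    refine (ih.union (ih.biUnion fun v _ => (G.neighborFinset v).finite_toSet)).subset ?_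
    intro v hv
    rcases Nat.lt_or_ge n (d v) with hlt | hle
    · obtain ⟨w, ⟨hw, hd⟩, -⟩ := h.existsUnique_parent v (by lia)
      refine Or.inr (Set.mem_biUnion (x := w) ?_ (by simpa using hw.symm))
      change d v ≤ n + 1 at hv
      change d w ≤ n
      lia
    · exact Or.inl hle

theorem nbrSum_root (h : IsRadial G e d) (hG : G.IsRegularOfDegree k) (φ : ℕ → ℝ) {v : V}
    (hv : d v = 0) : nbrSum G (φ ∘ d) v = k * φ 1 := by
  rw [nbrSum, Finset.sum_congr rfl (g := fun _ => φ 1), Finset.sum_const,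
    G.card_neighborFinset_eq_degree, hG v, nsmul_eq_mul]
  intro w hw
  have := h.adj ((G.mem_neighborFinset v w).1 hw)
  rw [Function.comp_apply, show d w = 1 by lia]

theorem nbrSum_of_eq_succ (h : IsRadial G e d) (hG : G.IsRegularOfDegree k) (φ : ℕ → ℝ) {v : V}
    {n : ℕ} (hv : d v = n + 1) :
    nbrSum G (φ ∘ d) v = φ n + (k - 1) * φ (n + 2) := by
  classical
  obtain ⟨u, ⟨hu, hd⟩, huniq⟩ := h.existsUnique_parent v (by lia)
  have hmem : u ∈ G.neighborFinset v := by simpa using hu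
  have hcard : ((G.neighborFinset v).erase u).card + 1 = k := by
    rw [Finset.card_erase_add_one hmem, G.card_neighborFinset_eq_degree, hG v]
  rw [nbrSum, ← Finset.add_sum_erase _ _ hmem,
    Finset.sum_congr rfl (g := fun _ => φ (n + 2)), Finset.sum_const, nsmul_eq_mul, ← hcard]
  · rw [Function.comp_apply, show d u = n by lia]
    push_cast
    ring
  · intro w hw
    rw [Finset.mem_erase, SimpleGraph.mem_neighborFinset] at hw
    have h1 : d v ≠ d w + 1 := fun h' => hw.1 (huniq w ⟨hw.2, h'⟩)
    have h2 := h.adj hw.2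
    rw [Function.comp_apply, show d w = n + 2 by lia]

/-- The comparison function `s⁻¹ ^ d` is not square-summable, so the bound is pointwise: the squared
norm is a value at `e` of a `2n`-th iterate, and there the function equals `1`. -/
theorem norm_markov_pow_delta_le (h : IsRadial G e d) (hG : G.IsRegularOfDegree k) (hk : 2 ≤ k)
    (n : ℕ) : ‖(markov G hG ^ n) (delta e)‖ ≤ (2 * √((k : ℝ) - 1) / k) ^ n := by
  classical
  have hk2 : (2 : ℝ) ≤ k := by exact_mod_cast hk
  set s := √((k : ℝ) - 1) with hs
  have hs0 : 0 < s := Real.sqrt_pos.2 (by linarith)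
  have hs2 : s ^ 2 = k - 1 := Real.sq_sqrt (by linarith)
  set φ : ℕ → ℝ := fun i => s⁻¹ ^ i with hφ
  have hstep : nbrSum G (φ ∘ d) ≤ (2 * s) • (φ ∘ d) := fun v => by
    rw [Pi.smul_apply, Function.comp_apply, smul_eq_mul]
    cases hv : d v with
    | zero =>
      rw [h.nbrSum_root hG φ hv]
      simp only [hφ, pow_one, pow_zero, mul_one]
      -- At the root the claim is `k ≤ 2 (k - 1)`, that is `2 ≤ k`.
      rw [← div_eq_mul_inv, div_le_iff₀ hs0]
      nlinarith
    | succ i =>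
      rw [h.nbrSum_of_eq_succ hG φ hv, ← hs2]
      simp only [hφ]
      refine le_of_eq ?_
      have q1 : s⁻¹ ^ (i + 1) = s⁻¹ ^ i * s⁻¹ := pow_succ _ _
      have q2 : s⁻¹ ^ (i + 2) = s⁻¹ ^ i * s⁻¹ ^ 2 := pow_add _ _ _
      rw [q1, q2]
      generalize s⁻¹ ^ i = p
      field_simp
      ring
  have hiter : ∀ m : ℕ, (nbrSum G)^[m] (φ ∘ d) ≤ (2 * s) ^ m • (φ ∘ d) := by
    intro m
    induction m with
    | zero => simp
    | succ m ih =>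
      rw [Function.iterate_succ_apply]
      refine (nbrSum_iterate_mono m hstep).trans ?_
      rw [nbrSum_iterate_smul, pow_succ', ← smul_smul (2 * s) ((2 * s) ^ m)]
      exact smul_le_smul_of_nonneg_left ih (mul_nonneg zero_le_two hs0.le)
  have hdelta : ⇑(delta e) ≤ φ ∘ d := fun v => by
    rw [delta_apply]
    split_ifs with hv
    · simp [hφ, (h.eq_zero_iff v).2 hv]
    · simp only [Function.comp_apply, hφ]
      positivity
  refine le_of_sq_le_sq ?_ (by positivity)
  rw [norm_markov_pow_delta_sq, coe_markov_pow, ← pow_mul, mul_comm n 2, div_eq_inv_mul, mul_pow,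
    Pi.smul_apply, smul_eq_mul]
  gcongr
  refine ((nbrSum_iterate_mono (2 * n) hdelta).trans (hiter (2 * n)) e).trans ?_
  simp [hφ, (h.eq_zero_iff e).2 rfl]

theorem norm_markov_le (h : IsRadial G e d) (hG : G.IsRegularOfDegree k) (hk : 2 ≤ k) :
    ‖markov G hG‖ ≤ 2 * √((k : ℝ) - 1) / k := by
  have hk2 : (2 : ℝ) ≤ k := by exact_mod_cast hk
  have : 0 < √((k : ℝ) - 1) := Real.sqrt_pos.2 (by linarith)
  exact norm_markov_le_of_growth hG (by lia) h.connected e (by positivity)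
    (h.norm_markov_pow_delta_le hG hk)

theorem mul_cos_le_norm_markov (h : IsRadial G e d) (hG : G.IsRegularOfDegree k) (hk : 2 ≤ k)
    (R : ℕ) : 2 * √((k : ℝ) - 1) / k * Real.cos (Real.pi / (R + 2)) ≤ ‖markov G hG‖ := by
  have hk2 : (2 : ℝ) ≤ k := by exact_mod_cast hk
  set s := √((k : ℝ) - 1) with hs
  have hs0 : 0 < s := Real.sqrt_pos.2 (by linarith)
  have hs2 : s ^ 2 = k - 1 := Real.sq_sqrt (by linarith)
  set θ := Real.pi / (R + 2) with hθ
  have hθR : (R + 2) * θ = Real.pi := by rw [hθ]; field_simp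
  have hθ0 : 0 < θ := by positivity
  have hcos : 0 ≤ Real.cos θ :=
    Real.cos_nonneg_of_neg_pi_div_two_le_of_le (by linarith [Real.pi_pos])
      (by nlinarith [(Nat.cast_nonneg R : (0 : ℝ) ≤ R)])
  -- Away from the root this solves the radial eigenvalue equation exactly, with eigenvalue `2 s cos
  -- θ`. Since `(R + 2) θ = π`, it vanishes at `R + 1`, so cutting it off after `R` leaves the
  -- equation intact up to `R`.
  set ψ : ℕ → ℝ := fun i => s⁻¹ ^ i * Real.sin ((i + 1) * θ) with hψ
  set φ : ℕ → ℝ := fun i => if i ≤ R then ψ i else 0 with hφ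
  have hφψ : ∀ i, i ≤ R + 1 → φ i = ψ i := fun i hi => by
    rcases hi.lt_or_eq with hlt | rfl
    · exact if_pos (by lia)
    · simp only [hφ, hψ, if_neg (show ¬ R + 1 ≤ R by lia)]
      rw [show (((R + 1 : ℕ) : ℝ) + 1) * θ = Real.pi by rw [← hθR]; push_cast; ring, Real.sin_pi,
        mul_zero]
  have hψ0 : ∀ i ≤ R, 0 ≤ ψ i := fun i hi => by
    have hi' : (i : ℝ) ≤ R := by exact_mod_cast hi
    refine mul_nonneg (by positivity) (Real.sin_nonneg_of_nonneg_of_le_pi (by positivity) ?_)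
    rw [← hθR]
    gcongr
    linarith
  have hφ0 : ∀ i, 0 ≤ φ i := fun i => by
    simp only [hφ]
    split_ifs with hi
    exacts [hψ0 i hi, le_rfl]
  have hstep : ∀ v, 2 * s * Real.cos θ * φ (d v) ≤ nbrSum G (φ ∘ d) v := fun v => by
    rcases Nat.lt_or_ge R (d v) with hlt | hle
    · rw [show φ (d v) = 0 from if_neg (by lia), mul_zero]
      exact nbrSum_nonneg G (fun w => hφ0 (d w)) v
    cases hv : d v with
    | zero =>
      rw [h.nbrSum_root hG φ hv, hφψ 0 (by lia), hφψ 1 (by lia)]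
      have hsin : 0 ≤ Real.sin θ := by simpa [hψ] using hψ0 0 (by lia)
      simp only [hψ, pow_zero, pow_one, Nat.cast_zero, Nat.cast_one, zero_add, one_mul]
      rw [one_add_one_eq_two, Real.sin_two_mul]
      have hsk : s ≤ k * s⁻¹ := by
        rw [← div_eq_mul_inv, le_div_iff₀ hs0]
        nlinarith
      have : 0 ≤ 2 * Real.sin θ * Real.cos θ := by positivity
      nlinarith [mul_le_mul_of_nonneg_right hsk this]
    | succ i =>
      rw [h.nbrSum_of_eq_succ hG φ hv, ← hs2, hφψ i (by lia), hφψ (i + 1) (by lia),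
        hφψ (i + 2) (by lia)]
      simp only [hψ]
      refine le_of_eq ?_
      have e1 : ((i : ℝ) + 1) * θ = (i + 2) * θ - θ := by ring
      have e2 : (((i + 2 : ℕ) : ℝ) + 1) * θ = (i + 2) * θ + θ := by push_cast; ring
      have e3 : (((i + 1 : ℕ) : ℝ) + 1) * θ = (i + 2) * θ := by push_cast; ring
      rw [e1, e2, e3, Real.sin_sub, Real.sin_add]
      have q1 : s⁻¹ ^ (i + 1) = s⁻¹ ^ i * s⁻¹ := pow_succ _ _
      have q2 : s⁻¹ ^ (i + 2) = s⁻¹ ^ i * s⁻¹ ^ 2 := pow_add _ _ _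
      rw [q1, q2]
      generalize s⁻¹ ^ i = p
      field_simp
      ring
  have hfin : (Function.support (φ ∘ d)).Finite :=
    (h.finite_le R).subset fun v hv => by
      by_contra hlt
      exact hv (if_neg hlt)
  let g : L2 V := ⟨φ ∘ d, memℓp_gen (summable_of_hasFiniteSupport
    (hfin.subset fun v hv h0 => hv (by simp only [h0]; simp)))⟩
  have hg : 0 < ‖g‖ := by
    refine norm_pos_iff.2 fun h0 => ?_
    have h1 : φ (d e) = 0 := congrFun (congrArg (fun f : L2 V => (f : V → ℝ)) h0) e
    rw [(h.eq_zero_iff e).2 rfl, hφψ 0 (by lia)] at h1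
    simp only [hψ, pow_zero, Nat.cast_zero, zero_add, one_mul] at h1
    refine (Real.sin_pos_of_pos_of_lt_pi hθ0 ?_).ne' h1
    nlinarith [(Nat.cast_nonneg R : (0 : ℝ) ≤ R)]
  refine le_of_mul_le_mul_right ?_ hg
  refine le_trans ?_ ((markov G hG).le_opNorm g)
  have hnn : 0 ≤ 2 * s / k * Real.cos θ := by positivity
  rw [← Real.norm_of_nonneg hnn, ← norm_smul]
  refine norm_le_norm_of_le (fun v => ?_) fun v => ?_
  · exact mul_nonneg hnn (hφ0 (d v))
  · change 2 * s / k * Real.cos θ * φ (d v) ≤ (k : ℝ)⁻¹ * nbrSum G (φ ∘ d) v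
    calc 2 * s / k * Real.cos θ * φ (d v) = (k : ℝ)⁻¹ * (2 * s * Real.cos θ * φ (d v)) := by ring
      _ ≤ _ := by gcongr; exact hstep v

theorem le_norm_markov (h : IsRadial G e d) (hG : G.IsRegularOfDegree k) (hk : 2 ≤ k) :
    2 * √((k : ℝ) - 1) / k ≤ ‖markov G hG‖ := by
  have h0 : Tendsto (fun R : ℕ => Real.pi / ((R : ℝ) + 2)) atTop (𝓝 0) :=
    (tendsto_natCast_atTop_atTop.atTop_add tendsto_const_nhds).const_div_atTop _
  have h1 := ((Real.continuous_cos.tendsto 0).comp h0).const_mul (2 * √((k : ℝ) - 1) / k)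
  rw [Real.cos_zero, mul_one] at h1
  exact le_of_tendsto' h1 fun R => h.mul_cos_le_norm_markov hG hk R

theorem norm_markov_eq (h : IsRadial G e d) (hG : G.IsRegularOfDegree k) (hk : 2 ≤ k) :
    ‖markov G hG‖ = 2 * √((k : ℝ) - 1) / k :=
  le_antisymm (h.norm_markov_le hG hk) (h.le_norm_markov hG hk)

end IsRadial

/-! ### Non-backtracking walks and their recursion. -/

section NonBacktracking

variable (G : SimpleGraph V) [G.LocallyFinite]

open Classical in
/-- The number of non-backtracking walks of length `n + 1` from `x` whose last step is from `a`
to `b`, for adjacent `a` and `b`. -/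
def nbDart (x : V) : ℕ → V → V → ℝ
  | 0, a, _ => if a = x then 1 else 0
  | n + 1, a, b => ∑ c ∈ (G.neighborFinset a).erase b, nbDart x n c a

/-- The number of non-backtracking walks of length `n` from `x` to `y`. -/
def nbWalk (x : V) : ℕ → V → ℝ
  | 0, y => delta x y
  | n + 1, y => nbrSum G (fun a => nbDart G x n a y) y

variable {G}

theorem nbDart_nonneg (x : V) (n : ℕ) (a b : V) : 0 ≤ nbDart G x n a b := by
  induction n generalizing a b with
  | zero => simp only [nbDart]; positivity
  | succ n ih => exact Finset.sum_nonneg fun c _ => ih c a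

theorem nbWalk_nonneg (x : V) (n : ℕ) (y : V) : 0 ≤ nbWalk G x n y := by
  cases n with
  | zero => exact delta_nonneg x y
  | succ n => exact Finset.sum_nonneg fun a _ => nbDart_nonneg x n a y

theorem nbrSum_nbWalk_zero (x : V) : nbrSum G (nbWalk G x 0) = nbWalk G x 1 := by
  classical
  ext y
  simp [nbWalk, nbrSum, nbDart, delta_apply]

/-- A further step to `y` either continues without backtracking or reverses a last step from `y` to
`a`. -/
theorem nbrSum_nbWalk_succ (x : V) (n : ℕ) (y : V) :
    nbrSum G (nbWalk G x (n + 1)) y =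
      nbWalk G x (n + 2) y + ∑ a ∈ G.neighborFinset y, nbDart G x n y a := by
  classical
  rw [nbWalk, nbrSum, nbrSum, ← Finset.sum_add_distrib]
  refine Finset.sum_congr rfl fun a ha => ?_
  have : y ∈ G.neighborFinset a := by simpa using ((G.mem_neighborFinset y a).1 ha).symm
  rw [nbWalk, nbrSum, ← Finset.sum_erase_add _ _ this, nbDart]

theorem nbrSum_nbWalk_one {k : ℕ} (hG : G.IsRegularOfDegree k) (x y : V) :
    nbrSum G (nbWalk G x 1) y = nbWalk G x 2 y + k * nbWalk G x 0 y := by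
  classical
  rw [nbrSum_nbWalk_succ, add_right_inj]
  simp only [nbDart, Finset.sum_const, nbWalk, delta_apply, G.card_neighborFinset_eq_degree, hG y,
    nsmul_eq_mul]

/-- A walk arriving at `y` can make an excursion to any neighbour except the one it came from, hence
`k - 1`. A walk of length `0` came from nowhere, hence `k` in `nbrSum_nbWalk_one`. -/
theorem nbrSum_nbWalk_add_two {k : ℕ} (hG : G.IsRegularOfDegree k) (x : V) (n : ℕ) (y : V) :
    nbrSum G (nbWalk G x (n + 2)) y =
      nbWalk G x (n + 3) y + (k - 1) * nbWalk G x (n + 1) y := by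
  classical
  rw [nbrSum_nbWalk_succ, add_right_inj]
  have h1 : ∀ a ∈ G.neighborFinset y,
      nbDart G x (n + 1) y a = nbWalk G x (n + 1) y - nbDart G x n a y := fun a ha => by
    rw [nbWalk, nbrSum, ← Finset.sum_erase_add _ _ ha, nbDart, add_sub_cancel_right]
  rw [Finset.sum_congr rfl h1, Finset.sum_sub_distrib, Finset.sum_const,
    G.card_neighborFinset_eq_degree, hG y, nsmul_eq_mul]
  conv_lhs => rw [nbWalk]
  rw [nbWalk, nbrSum]
  ring

end NonBacktracking

/-! ### Comparison of an arbitrary regular graph with the tree. -/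

section Comparison

variable (G : SimpleGraph V) [G.LocallyFinite] (d : W → ℕ) (x : V)

/-- The cone of pairs of functions spanned by the indicator functions of the spheres of a tree,
paired with the numbers of non-backtracking walks of the same length in `G`. -/
inductive SphericalPair : (W → ℝ) → (V → ℝ) → Prop
  | sphere (n : ℕ) : SphericalPair (Pi.single n (1 : ℝ) ∘ d) (nbWalk G x n)
  | add {F F' : W → ℝ} {H H' : V → ℝ} :
      SphericalPair F H → SphericalPair F' H' → SphericalPair (F + F') (H + H')
  | smul {c : ℝ} {F : W → ℝ} {H : V → ℝ} :
      0 ≤ c → SphericalPair F H → SphericalPair (c • F) (c • H)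

variable {G d x} {T : SimpleGraph W} [T.LocallyFinite] {k : ℕ} {e : W}

theorem IsRadial.nbrSum_sphere_zero (h : IsRadial T e d) (hT : T.IsRegularOfDegree k) :
    nbrSum T (Pi.single 0 (1 : ℝ) ∘ d) = Pi.single 1 (1 : ℝ) ∘ d := by
  ext v
  cases hv : d v with
  | zero => simp [h.nbrSum_root hT _ hv, hv]
  | succ i => simp [h.nbrSum_of_eq_succ hT _ hv, hv, Pi.single_apply]

theorem IsRadial.nbrSum_sphere_one (h : IsRadial T e d) (hT : T.IsRegularOfDegree k) :
    nbrSum T (Pi.single 1 (1 : ℝ) ∘ d) =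
      Pi.single 2 (1 : ℝ) ∘ d + (k : ℝ) • Pi.single 0 (1 : ℝ) ∘ d := by
  ext v
  cases hv : d v with
  | zero => simp [h.nbrSum_root hT _ hv, hv]
  | succ i => simp [h.nbrSum_of_eq_succ hT _ hv, hv, Pi.single_apply]

theorem IsRadial.nbrSum_sphere_add_two (h : IsRadial T e d) (hT : T.IsRegularOfDegree k) (n : ℕ) :
    nbrSum T (Pi.single (n + 2) (1 : ℝ) ∘ d) =
      Pi.single (n + 3) (1 : ℝ) ∘ d + ((k : ℝ) - 1) • Pi.single (n + 1) (1 : ℝ) ∘ d := by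
  ext v
  cases hv : d v with
  | zero => simp [h.nbrSum_root hT _ hv, hv]
  | succ i => simp [h.nbrSum_of_eq_succ hT _ hv, hv, Pi.single_apply]

/-- Spheres and non-backtracking counts satisfy identical recursions, whose coefficients `1`, `k`,
`k - 1` are nonnegative. -/
theorem SphericalPair.nbrSum (h : IsRadial T e d) (hT : T.IsRegularOfDegree k)
    (hG : G.IsRegularOfDegree k) (hk : 1 ≤ k) {F : W → ℝ} {H : V → ℝ}
    (hp : SphericalPair G d x F H) : SphericalPair G d x (nbrSum T F) (nbrSum G H) := by
  induction hp with
  | sphere n =>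
    match n with
    | 0 =>
      rw [h.nbrSum_sphere_zero hT, nbrSum_nbWalk_zero]
      exact .sphere 1
    | 1 =>
      rw [h.nbrSum_sphere_one hT, show RandomWalk.nbrSum G (nbWalk G x 1) =
        nbWalk G x 2 + (k : ℝ) • nbWalk G x 0 from funext (nbrSum_nbWalk_one hG x)]
      exact (SphericalPair.sphere 2).add ((SphericalPair.sphere 0).smul (Nat.cast_nonneg k))
    | n + 2 =>
      rw [h.nbrSum_sphere_add_two hT, show RandomWalk.nbrSum G (nbWalk G x (n + 2)) =
        nbWalk G x (n + 3) + ((k : ℝ) - 1) • nbWalk G x (n + 1) from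
          funext (nbrSum_nbWalk_add_two hG x n)]
      exact (SphericalPair.sphere (n + 3)).add ((SphericalPair.sphere (n + 1)).smul
        (sub_nonneg.2 (by exact_mod_cast hk)))
  | add _ _ ih ih' => rw [nbrSum_add, nbrSum_add]; exact ih.add ih'
  | smul hc _ ih => rw [nbrSum_smul, nbrSum_smul]; exact ih.smul hc

/-- Only the sphere of radius `0` meets the root, whereas `G` may also have closed non-backtracking
walks at `x`. -/
theorem SphericalPair.apply_le (he : d e = 0) {F : W → ℝ} {H : V → ℝ}
    (hp : SphericalPair G d x F H) : F e ≤ H x := by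
  classical
  induction hp with
  | sphere n =>
    rw [Function.comp_apply, he]
    cases n with
    | zero => simp [nbWalk, delta_apply]
    | succ n => simpa using nbWalk_nonneg x (n + 1) x
  | add _ _ ih ih' => exact add_le_add ih ih'
  | smul hc _ ih => exact mul_le_mul_of_nonneg_left ih hc

/-- The walk on a `k`-regular tree returns to its starting point with the smallest probability
among all `k`-regular graphs. -/
theorem IsRadial.norm_markov_pow_delta_le_norm (h : IsRadial T e d)
    (hT : T.IsRegularOfDegree k) (hG : G.IsRegularOfDegree k) (hk : 1 ≤ k) (x : V) (n : ℕ) :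
    ‖(markov T hT ^ n) (delta e)‖ ≤ ‖(markov G hG ^ n) (delta x)‖ := by
  classical
  have hp : ∀ m, SphericalPair G d x ((RandomWalk.nbrSum T)^[m] (delta e))
      ((RandomWalk.nbrSum G)^[m] (delta x)) := by
    intro m
    induction m with
    | zero =>
      have he : ⇑(delta e) = Pi.single 0 (1 : ℝ) ∘ d := by
        ext v
        simp [delta_apply, Pi.single_apply, h.eq_zero_iff]
      rw [Function.iterate_zero_apply, Function.iterate_zero_apply, he]
      exact .sphere 0
    | succ m ih =>
      rw [Function.iterate_succ_apply', Function.iterate_succ_apply']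
      exact ih.nbrSum h hT hG hk
  refine le_of_sq_le_sq ?_ (norm_nonneg _)
  rw [norm_markov_pow_delta_sq, norm_markov_pow_delta_sq, coe_markov_pow, coe_markov_pow,
    Pi.smul_apply, Pi.smul_apply]
  exact smul_le_smul_of_nonneg_left ((hp (2 * n)).apply_le ((h.eq_zero_iff e).2 rfl))
    (by positivity)

end Comparison

end Radial

/-! ### The zero-sum subspace and its test functions. -/

section ZeroSum

variable {V W : Type*} {G : SimpleGraph V}

theorem even_length_iff {I O : Set V} (h : G.IsBipartiteWith I O) {x y : V}
    (p : G.Walk x y) : Even p.length ↔ (x ∈ I ↔ y ∈ I) := by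
  induction p with
  | nil => simp
  | @cons a b c hab p ih =>
    have hd : ∀ {z}, z ∈ O → z ∉ I := fun hO hI => h.disjoint.le_bot ⟨hI, hO⟩
    rw [SimpleGraph.Walk.length_cons, Nat.even_add_one, ih]
    rcases h.mem_of_adj hab with ⟨ha, hb⟩ | ⟨ha, hb⟩
    · simp [ha, hd hb]
    · simp [hb, hd ha]

theorem hasSum_delta_indicator [DecidableEq V] (I : Set V) [DecidablePred (· ∈ I)] (x : V) :
    HasSum (I.indicator (delta x)) (if x ∈ I then 1 else 0) := by
  convert hasSum_ite_eq x (if x ∈ I then (1 : ℝ) else 0) using 2 with y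
  rw [Set.indicator_apply, delta_apply]
  split_ifs <;> simp_all

theorem delta_sub_delta_mem_L20 {x y : V} (p : G.Walk x y) (hp : Even p.length) :
    delta x - delta y ∈ L20 G := by
  classical
  refine ⟨fun _ => ?_, fun I O h _ => ?_⟩
  · simpa using (hasSum_delta_indicator Set.univ x).sub (hasSum_delta_indicator Set.univ y)
  · have key : ∀ J : Set V, (x ∈ J ↔ y ∈ J) →
        HasSum (fun z : J => (delta x - delta y : L2 V) z) 0 := fun J hJ => by
      refine (hasSum_subtype_iff_indicator (f := ⇑(delta x - delta y))).2 ?_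
      have := (hasSum_delta_indicator J x).sub (hasSum_delta_indicator J y)
      simp only [hJ, sub_self] at this
      rwa [lp.coeFn_sub, Set.indicator_sub']
    exact ⟨key I ((even_length_iff h p).1 hp),
      key O ((even_length_iff h.symm p).1 hp)⟩

theorem exists_dist_eq {u a b : V} {n : ℕ} (p : G.Walk a b) (ha : G.dist u a ≤ n)
    (hb : n ≤ G.dist u b) : ∃ w, G.dist u w = n := by
  induction p with
  | nil => exact ⟨_, le_antisymm ha hb⟩
  | @cons a c b hac p ih =>
    rcases ha.lt_or_eq with hlt | heq
    · exact ih (by rcases hac.diff_dist_adj (u := u) with h | h | h <;> lia) hb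
    · exact ⟨a, heq⟩

theorem exists_dist_eq_of_le_ediam (hc : G.Connected) {n : ℕ} (hn : ((n : ℕ) : ℕ∞) ≤ G.ediam) :
    ∃ x y, G.dist x y = n := by
  rcases Nat.eq_zero_or_pos n with rfl | hpos
  · obtain ⟨x⟩ := hc.nonempty
    exact ⟨x, x, G.dist_self⟩
  have : ∃ x y, n ≤ G.dist x y := by
    by_contra! h
    have h1 : G.ediam ≤ ((n - 1 : ℕ) : ℕ∞) := SimpleGraph.ediam_le_of_edist_le fun u v => by
      rw [← (hc u v).coe_dist_eq_edist]
      have := h u v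
      exact_mod_cast (by lia : G.dist u v ≤ n - 1)
    have h2 : n ≤ n - 1 := by exact_mod_cast hn.trans h1
    lia
  obtain ⟨x, y, hxy⟩ := this
  obtain ⟨p⟩ := hc x y
  obtain ⟨w, hw⟩ := exists_dist_eq (u := x) p (by simp) hxy
  exact ⟨x, w, hw⟩

variable [G.LocallyFinite] {k : ℕ}

/-- Double counting over oriented edges: weight each by `f` at its start, then reverse all edges.
Unconditional convergence in `ℝ` is absolute, which permits the rearrangement. -/
theorem hasSum_nbrSum (hG : G.IsRegularOfDegree k) {f : V → ℝ} {s : ℝ} (hf : HasSum f s) :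
    HasSum (nbrSum G f) (k * s) := by
  let D := Σ x : V, {y // y ∈ G.neighborFinset x}
  let F : D → ℝ := fun p => f p.1
  have hfib : ∀ (g : V → ℝ) (x : V),
      HasSum (fun _ : {y // y ∈ G.neighborFinset x} => g x) (k * g x) := fun g x => by
    convert hasSum_fintype (fun _ : {y // y ∈ G.neighborFinset x} => g x) using 1
    rw [Finset.sum_const, Finset.card_univ, Fintype.card_coe, G.card_neighborFinset_eq_degree,
      hG x, nsmul_eq_mul]
  have hsum : Summable F := by
    refine Summable.of_norm ((summable_sigma_of_nonneg fun _ => norm_nonneg _).2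
      ⟨fun x => (hfib (fun x => ‖f x‖) x).summable, ?_⟩)
    refine (hf.summable.norm.mul_left (k : ℝ)).congr fun x => ?_
    exact ((hfib (fun x => ‖f x‖) x).tsum_eq).symm
  have hF : HasSum F (k * s) := by
    have h1 := hsum.hasSum.sigma (fun x => hfib f x)
    rw [← h1.unique (hf.mul_left (k : ℝ))]
    exact hsum.hasSum
  let σ : D ≃ D :=
    { toFun := fun p => ⟨p.2.1, p.1, by simpa using ((G.mem_neighborFinset _ _).1 p.2.2).symm⟩
      invFun := fun p => ⟨p.2.1, p.1, by simpa using ((G.mem_neighborFinset _ _).1 p.2.2).symm⟩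
      left_inv := fun _ => rfl
      right_inv := fun _ => rfl }
  convert (σ.hasSum_iff.2 hF).sigma fun x => hasSum_fintype _ using 2 with x
  exact (Finset.sum_coe_sort (G.neighborFinset x) f).symm

theorem hasSum_avg (hG : G.IsRegularOfDegree k) (hk : 1 ≤ k) {f : V → ℝ} {s : ℝ}
    (hf : HasSum f s) : HasSum ((k : ℝ)⁻¹ • nbrSum G f) s := by
  have hk' : (k : ℝ) ≠ 0 := by positivity
  have := (hasSum_nbrSum hG hf).mul_left (k : ℝ)⁻¹
  rwa [inv_mul_cancel_left₀ hk'] at this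

/-- Summing over neighbours exchanges the two sides; this makes `L20` invariant in the bipartite
case. -/
theorem nbrSum_indicator {I O : Set V} (h : G.IsBipartiteWith I O) (hu : I ∪ O = Set.univ)
    (f : V → ℝ) : nbrSum G (I.indicator f) = O.indicator (nbrSum G f) := by
  classical
  ext x
  have hx : x ∈ I ∪ O := hu ▸ Set.mem_univ x
  by_cases hO : x ∈ O
  · rw [Set.indicator_of_mem hO]
    refine Finset.sum_congr rfl fun y hy => Set.indicator_of_mem ?_ f
    exact h.symm.mem_of_mem_adj hO (by simpa using hy)
  · rw [Set.indicator_of_notMem hO]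
    refine Finset.sum_eq_zero fun y hy => Set.indicator_of_notMem (fun hI => ?_) f
    exact h.disjoint.le_bot
      ⟨hI, h.mem_of_mem_adj (hx.resolve_right hO) (by simpa using hy)⟩

theorem hasSum_markov_part (hG : G.IsRegularOfDegree k) (hk : 1 ≤ k) {I O : Set V}
    (h : G.IsBipartiteWith I O) (hu : I ∪ O = Set.univ) {f : L2 V}
    (hf : HasSum (fun x : I => f x) 0) : HasSum (fun x : O => markov G hG f x) 0 := by
  have h1 : HasSum (I.indicator f) 0 := hasSum_subtype_iff_indicator.1 hf
  refine (hasSum_subtype_iff_indicator (f := ⇑(markov G hG f))).2 ?_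
  rw [coe_markov, show O.indicator ((k : ℝ)⁻¹ • nbrSum G f) = (k : ℝ)⁻¹ • O.indicator (nbrSum G f)
    from Set.indicator_const_smul O (k : ℝ)⁻¹ (nbrSum G f), ← nbrSum_indicator h hu]
  exact hasSum_avg hG hk h1

theorem markov_mem_L20 (hG : G.IsRegularOfDegree k) (hk : 1 ≤ k) {f : L2 V} (hf : f ∈ L20 G) :
    markov G hG f ∈ L20 G :=
  ⟨fun h => hasSum_avg hG hk (hf.1 h), fun I O h hu =>
    ⟨hasSum_markov_part hG hk h.symm (Set.union_comm I O ▸ hu) (hf.2 I O h hu).2,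
      hasSum_markov_part hG hk h hu (hf.2 I O h hu).1⟩⟩

theorem markov_pow_mem_L20 (hG : G.IsRegularOfDegree k) (hk : 1 ≤ k) {f : L2 V}
    (hf : f ∈ L20 G) (n : ℕ) : (markov G hG ^ n) f ∈ L20 G := by
  induction n with
  | zero => exact hf
  | succ n ih => rw [pow_succ', mul_apply_eq_comp]; exact markov_mem_L20 hG hk ih

theorem norm_markov_pow_le_of_mem_L20 (hG : G.IsRegularOfDegree k) (hk : 1 ≤ k) {f : L2 V}
    (hf : f ∈ L20 G) (n : ℕ) : ‖(markov G hG ^ n) f‖ ≤ ‖markov0 G hG‖ ^ n * ‖f‖ := by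
  induction n with
  | zero => simp
  | succ n ih =>
    rw [pow_succ', mul_apply_eq_comp, pow_succ', mul_assoc]
    exact ((markov0 G hG).le_opNorm ⟨_, markov_pow_mem_L20 hG hk hf n⟩).trans (by gcongr; exact ih)

theorem exists_walk_of_nbrSum_iterate_ne_zero {x : V} (n : ℕ) :
    ∀ y, (nbrSum G)^[n] (delta x) y ≠ 0 → ∃ p : G.Walk y x, p.length = n := by
  classical
  induction n with
  | zero =>
    intro y hy
    rw [Function.iterate_zero_apply, delta_apply, ne_eq, ite_eq_right_iff, not_forall] at hy
    obtain ⟨rfl, -⟩ := hy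
    exact ⟨.nil, rfl⟩
  | succ n ih =>
    intro y hy
    rw [Function.iterate_succ_apply'] at hy
    obtain ⟨z, hz, hne⟩ := Finset.exists_ne_zero_of_sum_ne_zero hy
    obtain ⟨p, hp⟩ := ih z hne
    exact ⟨.cons ((G.mem_neighborFinset y z).1 hz) p, by simp [hp]⟩

open scoped InnerProductSpace in
theorem inner_markov_pow_delta_eq_zero (hG : G.IsRegularOfDegree k) {x y : V} {r : ℕ}
    (h : 2 * r < G.dist x y) :
    ⟪(markov G hG ^ r) (delta x), (markov G hG ^ r) (delta y)⟫_ℝ = 0 := by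
  rw [inner_pow_pow (markov_symmetric hG), inner_delta_right, coe_markov_pow, Pi.smul_apply]
  by_contra hne
  obtain ⟨p, hp⟩ := exists_walk_of_nbrSum_iterate_ne_zero _ y (right_ne_zero_of_smul hne)
  have := G.dist_le p
  rw [G.dist_comm] at this
  lia

theorem IsRadial.norm_markov_pow_delta_le_norm_markov0 {T : SimpleGraph W} [T.LocallyFinite]
    {e : W} {d : W → ℕ} (h : IsRadial T e d) (hT : T.IsRegularOfDegree k)
    (hG : G.IsRegularOfDegree k) (hk : 1 ≤ k) (hc : G.Connected) {r : ℕ} (hr : 1 ≤ r)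
    (hdiam : ((2 * r + 2 : ℕ) : ℕ∞) ≤ G.ediam) :
    ‖(markov T hT ^ r) (delta e)‖ ^ (1 / (r : ℝ)) ≤ ‖markov0 G hG‖ := by
  obtain ⟨x, y, hxy⟩ := exists_dist_eq_of_le_ediam hc hdiam
  obtain ⟨p, hp⟩ := hc.exists_walk_length_eq_dist x y
  -- Orthogonality only needs distance above `2r`; the even value `2r + 2` also puts `x` and `y` on
  -- the same side of a bipartition.
  have hmem := delta_sub_delta_mem_L20 p (by rw [hp, hxy]; exact ⟨r + 1, by ring⟩)
  have h0 := inner_markov_pow_delta_eq_zero hG (x := x) (y := y) (r := 0) (by lia)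
  have h1 := inner_markov_pow_delta_eq_zero hG (x := x) (y := y) (r := r) (by lia)
  have hpow := norm_markov_pow_le_of_mem_L20 hG hk hmem r
  set t := ‖(markov T hT ^ r) (delta e)‖ with ht
  have hx := h.norm_markov_pow_delta_le_norm hT hG hk x r
  have hy := h.norm_markov_pow_delta_le_norm hT hG hk y r
  rw [pow_zero, one_apply_eq_self, one_apply_eq_self] at h0
  have e0 : ‖delta x - delta y‖ ^ 2 = 2 := by
    rw [norm_sub_sq_real, h0, norm_delta, norm_delta]; norm_num
  have e1 : 2 * t ^ 2 ≤ ‖(markov G hG ^ r) (delta x - delta y)‖ ^ 2 := by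
    rw [map_sub, norm_sub_sq_real, h1]
    have := pow_le_pow_left₀ (norm_nonneg _) hx 2
    have := pow_le_pow_left₀ (norm_nonneg _) hy 2
    linarith
  have e2 : t ^ 2 ≤ (‖markov0 G hG‖ ^ r) ^ 2 := by
    have := pow_le_pow_left₀ (norm_nonneg _) hpow 2
    rw [mul_pow, e0] at this
    linarith
  have hN : 0 ≤ ‖markov0 G hG‖ := ContinuousLinearMap.opNorm_nonneg _
  have hle := le_of_sq_le_sq e2 (pow_nonneg hN r)
  rw [← Real.rpow_natCast] at hle
  rw [one_div]
  exact (Real.rpow_inv_le_iff_of_pos (ht ▸ norm_nonneg _) hN (Nat.cast_pos.2 hr)).2 hle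

end ZeroSum

/-! ### A concrete regular tree: the Cayley graph of a free product of `k` groups of order two. -/

section WordTree

variable {k : ℕ}

/-- Words in `k` letters in which consecutive letters are distinct. -/
abbrev ReducedWord (k : ℕ) : Type := {l : List (Fin k) // l.IsChain (· ≠ ·)}

/-- The `k`-regular tree of reduced words: each word is adjacent to its tail. -/
def wordTree (k : ℕ) : SimpleGraph (ReducedWord k) where
  Adj l m := (∃ a, m.1 = a :: l.1) ∨ ∃ a, l.1 = a :: m.1
  symm := ⟨fun _ _ h => h.symm⟩
  loopless := ⟨fun l h => by
    rcases h with ⟨a, h⟩ | ⟨a, h⟩ <;> exact absurd (congrArg List.length h) (by simp)⟩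

/-- The neighbour of the reduced word `l` along an edge labelled `a`. -/
def ReducedWord.step (l : ReducedWord k) (a : Fin k) : ReducedWord k :=
  if h : l.1.head? = some a then ⟨l.1.tail, l.2.tail⟩
  else ⟨a :: l.1, List.isChain_cons.2 ⟨fun b hb hab => h (by rw [hab]; exact hb), l.2⟩⟩

theorem ReducedWord.step_injective (l : ReducedWord k) : Function.Injective l.step := by
  intro a b hab
  unfold ReducedWord.step at hab
  split_ifs at hab with h1 h2 h2
  · exact Option.some.inj (h1.symm.trans h2)
  · have := congrArg (fun m : ReducedWord k => m.1.length) hab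
    simp at this
  · have := congrArg (fun m : ReducedWord k => m.1.length) hab
    simp at this
    lia
  · have := congrArg Subtype.val hab
    simp at this
    exact this

/-- The edge to the tail is labelled by the deleted head, an edge to a longer word by the new
letter; reducedness keeps these labels apart. -/
theorem wordTree_neighborSet (l : ReducedWord k) :
    (wordTree k).neighborSet l = Set.range l.step := by
  ext m
  rw [SimpleGraph.mem_neighborSet, Set.mem_range]
  constructor
  · rintro (⟨a, h⟩ | ⟨a, h⟩)
    · have hm := m.2
      rw [h, List.isChain_cons] at hm
      refine ⟨a, ?_⟩
      rw [ReducedWord.step, dif_neg fun hh : l.1.head? = some a => hm.1 a hh rfl]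
      exact Subtype.ext h.symm
    · refine ⟨a, ?_⟩
      rw [ReducedWord.step, dif_pos (by simp [h])]
      exact Subtype.ext (by simp [h])
  · rintro ⟨a, rfl⟩
    unfold ReducedWord.step
    split_ifs with h
    · exact Or.inr ⟨a, (List.cons_head?_tail h).symm⟩
    · exact Or.inl ⟨a, rfl⟩

instance : (wordTree k).LocallyFinite := fun l =>
  Set.Finite.fintype (by rw [wordTree_neighborSet]; exact Set.finite_range _)

theorem wordTree_isRegularOfDegree : (wordTree k).IsRegularOfDegree k := fun l => by
  rw [← SimpleGraph.card_neighborSet_eq_degree, ← Nat.card_eq_fintype_card,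
    wordTree_neighborSet, Nat.card_range_of_injective l.step_injective, Nat.card_fin]

theorem isRadial_wordTree :
    IsRadial (wordTree k) ⟨[], List.isChain_nil⟩ fun l => l.1.length where
  eq_zero_iff l := by rw [List.length_eq_zero_iff, Subtype.ext_iff]
  adj h := by
    rcases h with ⟨a, h⟩ | ⟨a, h⟩
    · exact Or.inl (by simp [h])
    · exact Or.inr (by simp [h])
  existsUnique_parent l hl := by
    obtain ⟨a, t, h⟩ := List.exists_cons_of_length_pos (Nat.pos_of_ne_zero hl)
    refine ⟨⟨t, (h ▸ l.2).tail⟩, ⟨Or.inr ⟨a, h⟩, by simp [h]⟩, ?_⟩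
    rintro m ⟨⟨b, hb⟩ | ⟨b, hb⟩, hm⟩
    · simp [hb] at hm
      lia
    · rw [h, List.cons.injEq] at hb
      exact Subtype.ext hb.2.symm

end WordTree

/-! ### Graphs of bounded diameter, and infinite families. -/

section Family

variable {V : Type*} {G : SimpleGraph V} [G.LocallyFinite] {k : ℕ}

theorem exists_finset_ball (hG : G.IsRegularOfDegree k) (x : V) (n : ℕ) :
    ∃ s : Finset V, s.card ≤ (k + 1) ^ n ∧ ∀ y, ∀ p : G.Walk y x, p.length ≤ n → y ∈ s := by
  classical
  induction n with
  | zero =>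
    refine ⟨{x}, by simp, fun y p hp => ?_⟩
    rw [SimpleGraph.Walk.eq_of_length_eq_zero (Nat.le_zero.1 hp)]
    simp
  | succ n ih =>
    obtain ⟨s, hs, hmem⟩ := ih
    refine ⟨s.biUnion fun v => insert v (G.neighborFinset v), ?_, fun y p hp => ?_⟩
    · rw [pow_succ]
      refine (Finset.card_biUnion_le_card_mul _ _ (k + 1) fun v _ => ?_).trans
        (Nat.mul_le_mul_right _ hs)
      refine (Finset.card_insert_le _ _).trans ?_
      rw [G.card_neighborFinset_eq_degree, hG v]
    · rw [Finset.mem_biUnion]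
      cases p with
      | nil => exact ⟨x, hmem x .nil (by simp), by simp⟩
      | @cons _ z _ h q =>
        refine ⟨z, hmem z q ?_, by simp [h.symm]⟩
        rw [SimpleGraph.Walk.length_cons] at hp
        lia

theorem finite_of_ediam_lt (hG : G.IsRegularOfDegree k) (hc : G.Connected) {n : ℕ}
    (h : G.ediam < n) : Finite V ∧ Nat.card V ≤ (k + 1) ^ n := by
  obtain ⟨x⟩ := hc.nonempty
  obtain ⟨s, hs, hmem⟩ := exists_finset_ball hG x n
  have hall : ∀ y, y ∈ s := fun y => by
    obtain ⟨p, hp⟩ := hc.exists_walk_length_eq_edist y x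
    refine hmem y p ?_
    have : (p.length : ℕ∞) ≤ n := hp ▸ SimpleGraph.edist_le_ediam.trans h.le
    exact_mod_cast this
  have : Fintype V := ⟨s, hall⟩
  refine ⟨inferInstance, ?_⟩
  rw [Nat.card_eq_fintype_card]
  exact (Finset.card_le_card fun y _ => hall y).trans hs

/-- Supplies the uniform bound that makes the real `liminf` meaningful. -/
theorem norm_markov0_le_one (hG : G.IsRegularOfDegree k) : ‖markov0 G hG‖ ≤ 1 :=
  ContinuousLinearMap.opNorm_le_bound _ zero_le_one fun f =>
    (markov G hG).le_of_opNorm_le (norm_markov_le_one hG) f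

end Family

section Sequence

variable {V : ℕ → Type*} {G : ∀ n, SimpleGraph (V n)}

/-- Among infinitely many graphs with boundedly many vertices, infinitely many are isomorphic. -/
theorem finite_of_card_le (hiso : ∀ n, {m | Nonempty (G m ≃g G n)}.Finite) (K : ℕ) :
    {n | Finite (V n) ∧ Nat.card (V n) ≤ K}.Finite := by
  set S := {n | Finite (V n) ∧ Nat.card (V n) ≤ K} with hS
  by_contra hinf
  have : Infinite S := Set.infinite_coe_iff.2 hinf
  -- There are finitely many graphs on `Fin m` with `m ≤ K`, so infinitely many indices would share
  -- one model.
  have hex : ∀ n : S, ∃ a : Σ m : Fin (K + 1), SimpleGraph (Fin m), Nonempty (G n ≃g a.2) := by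
    rintro ⟨n, hfin, hn⟩
    have e : V n ≃ Fin (Nat.card (V n)) := Finite.equivFin (V n)
    exact ⟨⟨⟨Nat.card (V n), Nat.lt_succ_of_le hn⟩, (G n).map e⟩, ⟨SimpleGraph.Iso.map e (G n)⟩⟩
  choose c hc using hex
  obtain ⟨a, ha⟩ := Finite.exists_infinite_fiber c
  obtain ⟨n₀⟩ : Nonempty (c ⁻¹' {a}) := inferInstance
  have hsub : Subtype.val '' (c ⁻¹' {a}) ⊆ {m | Nonempty (G m ≃g G n₀.1)} := by
    rintro _ ⟨m, hm, rfl⟩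
    obtain ⟨f⟩ := hc m
    obtain ⟨g⟩ := hc n₀
    have h1 : c m = c n₀ := hm.trans n₀.2.symm
    rw [h1] at f
    exact ⟨f.trans g.symm⟩
  exact ((Set.infinite_coe_iff.1 ha).image Subtype.val_injective.injOn)
    ((hiso n₀.1).subset hsub)

variable [∀ n, (G n).LocallyFinite] {k : ℕ}

theorem le_liminf_norm_markov0 (hk : 1 ≤ k) (hG : ∀ n, (G n).IsRegularOfDegree k)
    (hc : ∀ n, (G n).Connected) (hiso : ∀ n, {m | Nonempty (G m ≃g G n)}.Finite) :
    2 * √((k : ℝ) - 1) / k ≤ liminf (fun n => ‖markov0 (G n) (hG n)‖) atTop := by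
  have hT := wordTree_isRegularOfDegree (k := k)
  have hR := isRadial_wordTree (k := k)
  set L := liminf (fun n => ‖markov0 (G n) (hG n)‖) atTop with hL
  have key : ∀ r : ℕ, 1 ≤ r →
      ‖(markov (wordTree k) hT ^ r) (delta ⟨[], List.isChain_nil⟩)‖ ^ (1 / (r : ℝ)) ≤ L := by
    intro r hr
    refine le_liminf_of_le
      (isCoboundedUnder_ge_of_le atTop fun n => norm_markov0_le_one (hG n)) ?_
    have hfin := finite_of_card_le hiso ((k + 1) ^ (2 * r + 2))
    rw [← Nat.cofinite_eq_atTop]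
    filter_upwards [hfin.compl_mem_cofinite] with n hn
    refine hR.norm_markov_pow_delta_le_norm_markov0 hT (hG n) hk (hc n) hr ?_
    by_contra! hlt
    exact hn (finite_of_ediam_lt (hG n) (hc n) hlt)
  -- The tree norm formula needs `2 ≤ k`; for `k = 1` the bound is `0`.
  rcases hk.lt_or_eq with hk2 | rfl
  · rw [← hR.norm_markov_eq hT hk2]
    refine le_of_tendsto (tendsto_norm_markov_pow_delta hT hk hR.connected
      ⟨[], List.isChain_nil⟩) ?_
    filter_upwards [eventually_ge_atTop 1] with r hr using key r hr
  · refine le_trans ?_ (key 1 le_rfl)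
    simp only [Nat.cast_one, sub_self, Real.sqrt_zero, mul_zero, zero_div]
    positivity

end Sequence

end RandomWalk

end

theorem mainTheorem9 (k : ℕ) (hk : 1 ≤ k) :
    -- the norm of the Markov operator through return probabilities and through iterates
    (∀ {V : Type*} (G : SimpleGraph V) [G.LocallyFinite] (hG : G.IsRegularOfDegree k),
      G.Connected → ∀ e : V,
        limsup (fun n : ℕ => RandomWalk.returnProb G e n ^ (1 / (n : ℝ))) atTop
            = ‖RandomWalk.markov G hG‖ ∧
        Tendsto (fun n : ℕ => RandomWalk.returnProb G e (2 * n) ^ (1 / (2 * (n : ℝ)))) atTop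
            (𝓝 ‖RandomWalk.markov G hG‖) ∧
        Tendsto (fun n : ℕ =>
            ‖(RandomWalk.markov G hG ^ n) (RandomWalk.delta e)‖ ^ (1 / (n : ℝ))) atTop
            (𝓝 ‖RandomWalk.markov G hG‖)) ∧
    -- the norm of the Markov operator of the `k`-regular tree
    (2 ≤ k → ∀ {W : Type*} (T : SimpleGraph W) [T.LocallyFinite]
      (hT : T.IsRegularOfDegree k), T.IsTree →
        ‖RandomWalk.markov T hT‖ = 2 * √((k : ℝ) - 1) / k) ∧
    -- comparison of a graph of diameter at least `2 r + 2` with the `k`-regular tree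
    (∀ {V W : Type*} (G : SimpleGraph V) [G.LocallyFinite] (hG : G.IsRegularOfDegree k)
      (T : SimpleGraph W) [T.LocallyFinite] (hT : T.IsRegularOfDegree k),
      G.Connected → T.IsTree → ∀ (e : W) (r : ℕ), 1 ≤ r → ((2 * r + 2 : ℕ) : ℕ∞) ≤ G.ediam →
        ‖(RandomWalk.markov T hT ^ r) (RandomWalk.delta e)‖ ^ (1 / (r : ℝ))
          ≤ ‖RandomWalk.markov0 G hG‖) ∧
    -- the lower bound for an infinite family
    (∀ (V : ℕ → Type*) (G : ∀ n, SimpleGraph (V n)) [∀ n, (G n).LocallyFinite]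
      (hG : ∀ n, (G n).IsRegularOfDegree k),
      (∀ n, (G n).Connected) → (∀ n, {m | Nonempty (G m ≃g G n)}.Finite) →
        2 * √((k : ℝ) - 1) / k
          ≤ liminf (fun n => ‖RandomWalk.markov0 (G n) (hG n)‖) atTop) := by
  refine ⟨fun G _ hG hc e => ⟨RandomWalk.limsup_returnProb hG hk hc e,
      RandomWalk.tendsto_returnProb_even hG hk hc e,
      RandomWalk.tendsto_norm_markov_pow_delta hG hk hc e⟩,
    fun hk2 _ T _ hT hTree => ?_,
    fun G _ hG T _ hT hc hTree e r hr hdiam =>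
      (RandomWalk.isRadial_dist hTree e).norm_markov_pow_delta_le_norm_markov0 hT hG hk hc hr hdiam,
    fun V G _ hG hc hiso => RandomWalk.le_liminf_norm_markov0 hk hG hc hiso⟩
  obtain ⟨e⟩ := hTree.connected.nonempty
  exact (RandomWalk.isRadial_dist hTree e).norm_markov_eq hT hk2
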